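/- Let $\mathbb{A}$ be a finite-dimensional, unital, not necessarily associative real division algebra: a nonzero real algebra with unit in which, for all $a\neq 0$ and all $b$, each of the equations $ax=b$ and $xa=b$ has exactly one solution. Let $G=\mathrm{Aut}(\mathbb{A})$ be the group of all bijective linear maps $g:\mathbb{A}\to\mathbb{A}$ with $g(xy)=g(x)g(y)$, with the subspace topology of $GL(\mathbb{A})$. Let $P(x)=\sum_k a_kx^k\in\mathbb{R}[x]$, evaluated on $\mathbb{A}$ with $x^0=1$, $x^{k+1}=x^k\,x$ (if $\mathbb{A}$ is power-associative, as $\mathbb{H}$ and $\mathbb{O}$ are, the bracketing is irrelevant), and let $Z(P)=\{x\in\mathbb{A} : P(x)=0\}$. Let $\alpha\in Z(P)$ not lie in the center of $\mathbb{A}$ (the set of elements that commute with all elements and associate with all pairs of elements), and let $H=\mathrm{Stab}_G(\alpha)$. Then $Z(P)$ contains the orbit $G\alpha=\{g(\alpha): g\in G\}$, and this orbit is a submanifold of $\mathbb{A}$ diffeomorphic to the homogeneous space $G/H$. Precisely: $G$ has a Lie group structure for which the inclusion $G\hookrightarrow\mathrm{End}(\mathbb{A})$ is a smooth embedding; the quotient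 space $G/H$ has a smooth manifold structure for which the projection $G\to G/H$ is a smooth submersion; the orbit $G\alpha$, with the subspace topology, has a smooth manifold structure for which the inclusion $G\alpha\hookrightarrow\mathbb{A}$ is a smooth embedding; and $gH\mapsto g(\alpha)$ is a diffeomorphism $G/H\to G\alpha$. -/

import Mathlib

open scoped Manifold ContDiff Polynomial

/-- A unital, not necessarily associative ring together with a norm on its underlying additive
group. The norm is *not* required to be compatible with the multiplication: it only serves to
speak of topology and smoothness on a finite-dimensional real vector space, where all norms are
equivalent and at least one exists. -/
class NonAssocRingWithNorm (A : Type*) extends NonAssocRing A, NormedAddCommGroup A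

/-- A (not necessarily associative) division algebra: a nonzero algebra in which, for every
`a ≠ 0` and every `b`, each of the equations `a * x = b` and `x * a = b` has exactly one
solution. -/
class IsDivisionAlgebra (A : Type*) [NonUnitalNonAssocRing A] : Prop where
  nontrivial : Nontrivial A
  mul_left_bijective : ∀ a : A, a ≠ 0 → Function.Bijective fun x : A => a * x
  mul_right_bijective : ∀ a : A, a ≠ 0 → Function.Bijective fun x : A => x * a

/-- The value `P(x) = ∑ aₖ xᵏ` of a real polynomial at an element of a unital, not necessarily
associative real algebra, where `x⁰ = 1` and `xᵏ⁺¹ = xᵏ * x`. -/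
noncomputable def evalAt {A : Type*} [NonAssocRing A] [Module ℝ A] (P : ℝ[X]) (x : A) : A :=
  P.sum fun k a => a • npowRec k x

/-- The solution set `Z(P) = {x ∈ A | P(x) = 0}`. -/
def zeroSet {A : Type*} [NonAssocRing A] [Module ℝ A] (P : ℝ[X]) : Set A :=
  {x | evalAt P x = 0}

/-- The automorphism group `Aut(A)`: all invertible (continuous) linear maps `g : A → A` with
`g (x * y) = g x * g y`, as a subgroup of the general linear group `GL(A) = (A →L[ℝ] A)ˣ`.
(In finite dimension every linear map is continuous.) It carries the subspace topology of `GL(A)`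
and acts on `A` by evaluation, `g • x = g x`. -/
def autGroup (A : Type*) [NonAssocRingWithNorm A] [NormedSpace ℝ A] :
    Subgroup (A →L[ℝ] A)ˣ where
  carrier := {g | ∀ x y : A, (g : A →L[ℝ] A) (x * y) = (g : A →L[ℝ] A) x * (g : A →L[ℝ] A) y}
  one_mem' := fun x y => rfl
  mul_mem' := by
    intro g h hg hh x y
    have e : ∀ z : A, ((g * h : (A →L[ℝ] A)ˣ) : A →L[ℝ] A) z
        = (g : A →L[ℝ] A) ((h : A →L[ℝ] A) z) := fun z => rfl
    rw [e, e, e, hh, hg]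
  inv_mem' := by
    intro g hg x y
    have e : ∀ z : A, (g : A →L[ℝ] A) (((g⁻¹ : (A →L[ℝ] A)ˣ) : A →L[ℝ] A) z) = z := fun z =>
      congrArg (fun f : A →L[ℝ] A => f z) g.mul_inv
    have e' : ∀ z : A, ((g⁻¹ : (A →L[ℝ] A)ˣ) : A →L[ℝ] A) ((g : A →L[ℝ] A) z) = z := fun z =>
      congrArg (fun f : A →L[ℝ] A => f z) g.inv_mul
    have h := hg (((g⁻¹ : (A →L[ℝ] A)ˣ) : A →L[ℝ] A) x) (((g⁻¹ : (A →L[ℝ] A)ˣ) : A →L[ℝ] A) y)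
    rw [e, e] at h
    rw [← h, e']

/-! Automorphisms preserve real polynomial equations, so the orbit lies in `Z(P)`. The rest is a
closed-subgroup argument made explicit. Exponentials of derivations are automorphisms. Choose a
complement of the derivations killing `α` inside all derivations, and a complement of the
derivations inside `End(A)`. The map `(a, b, c) ↦ exp a * exp b * (1 + c)` is then a local
diffeomorphism at `0`, with `a` in the first complement, `b` killing `α`, and `c` in the second
complement. Near `0` its value is an automorphism exactly when `c = 0`, because the linearized
condition at the identity says that `c` is a derivation. This gives a slice chart of `G` at `1`.
Similarly, `(a, v) ↦ exp a α + v` gives coordinates of `A` at `α`.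

Compactness of `G` makes these coordinates slice the whole orbit: boundedness follows from the
absence of nonzero `x` with `x * x = 0`, and `G/H → A` is then a topological embedding, so the orbit
cannot return near `α` from far away. Since `exp b` fixes `α`, the orbit map is `(a, b) ↦ a` in
these charts. Translation by `G` carries the charts to all points. -/

open Topology

/-! ### Submanifold structures from slice charts -/

section Slice

variable {E F V M : Type*} [NormedAddCommGroup E] [NormedSpace ℝ E] [NormedAddCommGroup F]
  [NormedSpace ℝ F] [NormedAddCommGroup V] [NormedSpace ℝ V] [TopologicalSpace M]

/-- A slice chart of a subset `S` of a normed space: a smooth chart of the ambient space in which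
`S` becomes the subspace `E × 0` of `E × F`. -/
structure IsSliceChart (S : Set V) (ψ : OpenPartialHomeomorph V (E × F)) : Prop where
  contDiffOn : ContDiffOn ℝ ∞ ψ ψ.source
  contDiffOn_symm : ContDiffOn ℝ ∞ ψ.symm ψ.target
  mem_iff : ∀ v ∈ ψ.source, v ∈ S ↔ (ψ v).2 = 0

theorem IsSliceChart.symm_mem {S : Set V} {ψ : OpenPartialHomeomorph V (E × F)}
    (hψ : IsSliceChart S ψ) {e : E} (he : (e, 0) ∈ ψ.target) : ψ.symm (e, 0) ∈ S := by
  rw [hψ.mem_iff _ (ψ.map_target he), ψ.right_inv he]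

theorem IsSliceChart.apply_eq {S : Set V} {ψ : OpenPartialHomeomorph V (E × F)}
    (hψ : IsSliceChart S ψ) {v : V} (hv : v ∈ ψ.source) (hS : v ∈ S) : ψ v = ((ψ v).1, 0) :=
  Prod.ext rfl ((hψ.mem_iff v hv).1 hS)

/-- Slice charts can be transported along linear equivalences preserving the subset. -/
theorem IsSliceChart.transport {S : Set V} {ψ : OpenPartialHomeomorph V (E × F)}
    (hψ : IsSliceChart S ψ) (T : V ≃L[ℝ] V) (hT : ∀ v, T v ∈ S ↔ v ∈ S) :
    IsSliceChart S (T.toHomeomorph.transOpenPartialHomeomorph ψ) where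
  contDiffOn := hψ.contDiffOn.comp T.contDiff.contDiffOn fun _ hv => hv
  contDiffOn_symm := T.symm.contDiff.comp_contDiffOn hψ.contDiffOn_symm
  mem_iff v hv := (hT v).symm.trans (hψ.mem_iff (T v) hv)

/-- The chart induced by a slice chart on a space embedded with image the given subset. -/
noncomputable def IsSliceChart.toChart [Nonempty M] {ι : M → V} (hι : IsEmbedding ι)
    {ψ : OpenPartialHomeomorph V (E × F)} (hψ : IsSliceChart (Set.range ι) ψ) :
    OpenPartialHomeomorph M E where
  toFun x := (ψ (ι x)).1
  invFun e := Function.invFun ι (ψ.symm (e, 0))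
  source := ι ⁻¹' ψ.source
  target := {e | (e, 0) ∈ ψ.target}
  map_source' x hx := by
    have := ψ.map_source hx
    rwa [hψ.apply_eq hx ⟨x, rfl⟩] at this
  map_target' e he := by
    change ι _ ∈ ψ.source
    rw [Function.invFun_eq (hψ.symm_mem he)]
    exact ψ.map_target he
  left_inv' x hx := by
    rw [← hψ.apply_eq hx ⟨x, rfl⟩, ψ.left_inv hx]
    exact Function.leftInverse_invFun hι.injective x
  right_inv' e he := by
    rw [Function.invFun_eq (hψ.symm_mem he), ψ.right_inv he]
  open_source := ψ.open_source.preimage hι.continuous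
  open_target := ψ.open_target.preimage (by fun_prop)
  continuousOn_toFun :=
    continuous_fst.comp_continuousOn (ψ.continuousOn.comp hι.continuous.continuousOn fun _ h => h)
  continuousOn_invFun := by
    rw [hι.isInducing.continuousOn_iff]
    have h : ContinuousOn (fun e : E => ψ.symm (e, 0)) {e | (e, 0) ∈ ψ.target} :=
      ψ.continuousOn_symm.comp (by fun_prop) fun _ h => h
    exact h.congr fun e he => Function.invFun_eq (hψ.symm_mem he)

section toChart

variable [Nonempty M] {ι : M → V} (hι : IsEmbedding ι)
    {ψ : OpenPartialHomeomorph V (E × F)} (hψ : IsSliceChart (Set.range ι) ψ)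

@[simp] theorem IsSliceChart.toChart_target :
    (hψ.toChart hι).target = {e | (e, 0) ∈ ψ.target} := rfl

theorem IsSliceChart.apply_toChart_symm {e : E} (he : (e, 0) ∈ ψ.target) :
    ι ((hψ.toChart hι).symm e) = ψ.symm (e, 0) :=
  Function.invFun_eq (hψ.symm_mem he)

end toChart

/-- The charted space structure on an embedded space whose image is covered by slice charts. -/
noncomputable abbrev sliceChartedSpace [Nonempty M] {ι : M → V} (hι : IsEmbedding ι)
    (h : ∀ x, ∃ ψ : OpenPartialHomeomorph V (E × F),
      IsSliceChart (Set.range ι) ψ ∧ ι x ∈ ψ.source) : ChartedSpace E M where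
  atlas := {c | ∃ (ψ : OpenPartialHomeomorph V (E × F)) (hψ : IsSliceChart (Set.range ι) ψ),
    c = hψ.toChart hι}
  chartAt x := (h x).choose_spec.1.toChart hι
  mem_chart_source x := (h x).choose_spec.2
  chart_mem_atlas _ := ⟨_, _, rfl⟩

variable [Nonempty M] {ι : M → V} (hι : IsEmbedding ι)
    (h : ∀ x, ∃ ψ : OpenPartialHomeomorph V (E × F),
      IsSliceChart (Set.range ι) ψ ∧ ι x ∈ ψ.source)

/-- A change of charts is `e ↦ (ψ' (ψ.symm (e, 0))).1`, a composite of smooth maps. -/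
theorem isManifold_slice :
    letI := sliceChartedSpace hι h
    IsManifold 𝓘(ℝ, E) ∞ M := by
  let := sliceChartedSpace hι h
  refine isManifold_of_contDiffOn _ _ _ ?_
  rintro _ _ ⟨ψ, hψ, rfl⟩ ⟨ψ', hψ', rfl⟩
  have h1 : ContDiffOn ℝ ∞ (fun e : E => ψ.symm (e, 0)) {e | (e, 0) ∈ ψ.target} :=
    hψ.contDiffOn_symm.comp (f := fun e : E => (e, (0 : F))) (by fun_prop) fun _ h => h
  have key : ∀ e, e ∈ ((hψ.toChart hι).symm ≫ₕ hψ'.toChart hι).source →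
      (e, 0) ∈ ψ.target ∧ ψ.symm (e, 0) ∈ ψ'.source := by
    intro e he
    have he1 : (e, 0) ∈ ψ.target := he.1
    have he2 : ι ((hψ.toChart hι).symm e) ∈ ψ'.source := he.2
    rw [hψ.apply_toChart_symm hι he1] at he2
    exact ⟨he1, he2⟩
  have h2 : ContDiffOn ℝ ∞ (fun e : E => (ψ' (ψ.symm (e, 0))).1)
      ((hψ.toChart hι).symm ≫ₕ hψ'.toChart hι).source :=
    contDiff_fst.comp_contDiffOn
      (hψ'.contDiffOn.comp (h1.mono fun e he => (key e he).1) fun e he => (key e he).2)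
  refine (h2.congr fun e he => ?_).mono fun e he => he.1
  change (ψ' (ι ((hψ.toChart hι).symm e))).1 = _
  rw [hψ.apply_toChart_symm hι (key e he).1]

theorem IsSliceChart.toChart_mem_maximalAtlas {ψ : OpenPartialHomeomorph V (E × F)}
    (hψ : IsSliceChart (Set.range ι) ψ) :
    letI := sliceChartedSpace hι h
    hψ.toChart hι ∈ IsManifold.maximalAtlas 𝓘(ℝ, E) ∞ M := by
  let := sliceChartedSpace hι h
  have := isManifold_slice hι h
  exact IsManifold.subset_maximalAtlas ⟨ψ, hψ, rfl⟩

/-- In slice charts the embedding reads `e ↦ (e, 0)`. The equivalence `Λ` turns a slice chart into a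
chart of `V` modelled on `V` itself. -/
theorem isSmoothEmbedding_slice (Λ : (E × F) ≃L[ℝ] V) :
    letI := sliceChartedSpace hι h
    Manifold.IsSmoothEmbedding 𝓘(ℝ, E) 𝓘(ℝ, V) ∞ ι := by
  let := sliceChartedSpace hι h
  refine ⟨?_, hι⟩
  have H : Manifold.IsImmersionOfComplement F 𝓘(ℝ, E) 𝓘(ℝ, V) ∞ ι := by
    intro x
    obtain ⟨ψ, hψ, hx⟩ := h x
    have hχ : ψ.transHomeomorph Λ.toHomeomorph ∈ IsManifold.maximalAtlas 𝓘(ℝ, V) ∞ V := by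
      have a1 : ContDiffOn ℝ ∞ (ψ.transHomeomorph Λ.toHomeomorph) ψ.source :=
        Λ.contDiff.comp_contDiffOn hψ.contDiffOn
      have a2 : ContDiffOn ℝ ∞ (ψ.transHomeomorph Λ.toHomeomorph).symm
          (Λ.symm ⁻¹' ψ.target) :=
        hψ.contDiffOn_symm.comp Λ.symm.contDiff.contDiffOn fun _ h => h
      exact OpenPartialHomeomorph.mem_maximalAtlas_of_contMDiffOn _
        (contMDiffOn_iff_contDiffOn.2 a1) (contMDiffOn_iff_contDiffOn.2 a2)
    refine Manifold.IsImmersionAtOfComplement.mk_of_charts Λ (hψ.toChart hι)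
      (ψ.transHomeomorph Λ.toHomeomorph) hx hx (hψ.toChart_mem_maximalAtlas hι h) hχ
      subset_rfl ?_
    intro e he
    have he' : (e, 0) ∈ ψ.target := by simpa using he
    change Λ (ψ (ι ((hψ.toChart hι).symm e))) = Λ (e, 0)
    rw [hψ.apply_toChart_symm hι he', ψ.right_inv he']
  exact H.isImmersion

end Slice

/-! ### Automorphisms, exponentials of derivations, compactness -/

section Aut

variable {A : Type*} [NonAssocRingWithNorm A] [NormedSpace ℝ A]

/-- An automorphism as a continuous linear endomorphism. -/
def autToEnd (g : autGroup A) : A →L[ℝ] A := ((g : (A →L[ℝ] A)ˣ) : A →L[ℝ] A)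

theorem autToEnd_apply_mul (g : autGroup A) (x y : A) :
    autToEnd g (x * y) = autToEnd g x * autToEnd g y := g.2 x y

theorem autToEnd_mul (g h : autGroup A) : autToEnd (g * h) = autToEnd g * autToEnd h := rfl

theorem autToEnd_one : autToEnd (1 : autGroup A) = 1 := rfl

theorem autToEnd_inv_mul (g : autGroup A) : autToEnd (g⁻¹) * autToEnd g = 1 := by
  rw [← autToEnd_mul, inv_mul_cancel, autToEnd_one]

theorem autToEnd_mul_inv (g : autGroup A) : autToEnd g * autToEnd (g⁻¹) = 1 := by
  rw [← autToEnd_mul, mul_inv_cancel, autToEnd_one]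

theorem autToEnd_inv_apply (g : autGroup A) (x : A) : autToEnd (g⁻¹) (autToEnd g x) = x :=
  congrArg (fun f : A →L[ℝ] A => f x) (autToEnd_inv_mul g)

theorem isEmbedding_autToEnd [CompleteSpace A] :
    IsEmbedding (autToEnd : autGroup A → A →L[ℝ] A) :=
  Units.isOpenEmbedding_val.isEmbedding.comp IsEmbedding.subtypeVal

/-- Cancel the nonzero element `g 1` in `g 1 * g 1 = g 1 * 1`. -/
theorem autToEnd_one_apply [IsDivisionAlgebra A] (g : autGroup A) : autToEnd g 1 = 1 := by
  have := IsDivisionAlgebra.nontrivial (A := A)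
  have hne : autToEnd g 1 ≠ 0 := by
    intro h
    have := autToEnd_inv_apply g 1
    rw [h, map_zero] at this
    exact zero_ne_one this
  apply (IsDivisionAlgebra.mul_left_bijective _ hne).injective
  change _ * _ = _ * _
  rw [← autToEnd_apply_mul g, mul_one, mul_one]

theorem autToEnd_npowRec [IsDivisionAlgebra A] (g : autGroup A) (k : ℕ) (x : A) :
    autToEnd g (npowRec k x) = npowRec k (autToEnd g x) := by
  induction k with
  | zero => exact autToEnd_one_apply g
  | succ k ih =>
    change autToEnd g (npowRec k x * x) = npowRec k (autToEnd g x) * autToEnd g x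
    rw [autToEnd_apply_mul g, ih]

theorem autToEnd_evalAt [IsDivisionAlgebra A] (g : autGroup A) (P : ℝ[X]) (x : A) :
    autToEnd g (evalAt P x) = evalAt P (autToEnd g x) := by
  simp only [evalAt, Polynomial.sum, map_sum, map_smul, autToEnd_npowRec g]

theorem orbit_subset_zeroSet [IsDivisionAlgebra A] {P : ℝ[X]} {α : A} (hα : α ∈ zeroSet P) :
    MulAction.orbit (autGroup A) α ⊆ zeroSet P := by
  rintro _ ⟨g, rfl⟩
  change evalAt P (autToEnd g α) = 0
  rw [← autToEnd_evalAt g, show evalAt P α = 0 from hα, map_zero]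

/-- The map from the homogeneous space of a point onto its orbit. -/
def orbitMap (α : A) : autGroup A ⧸ MulAction.stabilizer (autGroup A) α → A :=
  MulAction.ofQuotientStabilizer (autGroup A) α

theorem range_orbitMap (α : A) : Set.range (orbitMap α) = MulAction.orbit (autGroup A) α := by
  ext x
  constructor
  · rintro ⟨q, rfl⟩
    induction q using QuotientGroup.induction_on with
    | H g => exact ⟨g, rfl⟩
  · rintro ⟨g, rfl⟩
    exact ⟨(g : autGroup A ⧸ _), rfl⟩

/-- The derivations of a not necessarily associative algebra. -/
def derivations (A : Type*) [NonAssocRingWithNorm A] [NormedSpace ℝ A]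
    [IsScalarTower ℝ A A] [SMulCommClass ℝ A A] : Submodule ℝ (A →L[ℝ] A) where
  carrier := {D | ∀ x y, D (x * y) = D x * y + x * D y}
  zero_mem' x y := by simp
  add_mem' {D D'} h h' x y := by
    simp only [add_apply, h x y, h' x y, add_mul, mul_add]; abel
  smul_mem' c D h x y := by
    simp only [smul_apply, h x y, smul_add, smul_mul_assoc, mul_smul_comm]

/-- The derivations which annihilate a given element. -/
noncomputable def annihilatingDerivations [IsScalarTower ℝ A A] [SMulCommClass ℝ A A] (α : A) :
    Submodule ℝ (A →L[ℝ] A) :=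
  derivations A ⊓ LinearMap.ker (ContinuousLinearMap.apply ℝ A α).toLinearMap

variable [FiniteDimensional ℝ A]

theorem NormedSpace.exp_apply_eq_of_apply_eq_zero {D : A →L[ℝ] A} {x : A} (h : D x = 0) :
    NormedSpace.exp D x = x := by
  have : CompleteSpace A := FiniteDimensional.complete ℝ A
  have h1 : ∀ t : ℝ, HasDerivAt (fun u : ℝ => NormedSpace.exp (u • D) x) 0 t := fun t => by
    simpa [h] using (hasDerivAt_exp_smul_const D t).clm_apply (hasDerivAt_const t x)
  have := is_const_of_deriv_eq_zero (fun t => (h1 t).differentiableAt) (fun t => (h1 t).deriv) 1 0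
  simpa using this

theorem contDiff_exp_end : ContDiff ℝ ∞ (NormedSpace.exp : (A →L[ℝ] A) → (A →L[ℝ] A)) := by
  have : CompleteSpace A := FiniteDimensional.complete ℝ A
  exact contDiff_iff_contDiffAt.2 fun x =>
    (NormedSpace.exp_analytic (𝕂 := ℝ) x).contDiffAt

/-- A multiplicative `f` with `f 1 = 1` kills no nonzero `x`, since `x * y = 1` is solvable; in
finite dimension it is then invertible. The invertibility condition thus disappears, leaving closed
equations. -/
theorem range_autToEnd [IsDivisionAlgebra A] :
    Set.range (autToEnd : autGroup A → A →L[ℝ] A)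
      = {f | (∀ x y, f (x * y) = f x * f y) ∧ f 1 = 1} := by
  ext f
  constructor
  · rintro ⟨g, rfl⟩
    exact ⟨autToEnd_apply_mul g, autToEnd_one_apply g⟩
  · rintro ⟨hm, h1⟩
    have := IsDivisionAlgebra.nontrivial (A := A)
    have hinj : Function.Injective f := by
      rw [injective_iff_map_eq_zero]
      intro x hx
      by_contra hne
      obtain ⟨y, hy⟩ := (IsDivisionAlgebra.mul_left_bijective x hne).surjective 1
      have hy : x * y = 1 := hy
      have := hm x y
      rw [hy, h1, hx, zero_mul] at this
      exact one_ne_zero this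
    let e := (LinearEquiv.ofInjectiveEndo f.toLinearMap hinj).toContinuousLinearEquiv
    exact ⟨⟨ContinuousLinearEquiv.toUnit e, hm⟩, rfl⟩

variable [IsScalarTower ℝ A A] [SMulCommClass ℝ A A]

/-- The multiplication of a finite-dimensional algebra as a continuous bilinear map. -/
noncomputable def mulCLM (A : Type*) [NonAssocRingWithNorm A] [NormedSpace ℝ A]
    [FiniteDimensional ℝ A] [IsScalarTower ℝ A A] [SMulCommClass ℝ A A] : A →L[ℝ] A →L[ℝ] A :=
  (LinearMap.mul ℝ A).toContinuousBilinearMap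

@[simp] theorem mulCLM_apply (x y : A) : mulCLM A x y = x * y := rfl

/-- By the Leibniz rule, `exp(tD) x * exp(tD) y` solves the linear equation `z' = D z`, so applying
`exp(-tD)` to it gives a constant; compare `t = 0` and `t = 1`. -/
theorem exp_apply_mul {D : A →L[ℝ] A} (hD : D ∈ derivations A) (x y : A) :
    NormedSpace.exp D (x * y) = NormedSpace.exp D x * NormedSpace.exp D y := by
  have : CompleteSpace A := FiniteDimensional.complete ℝ A
  let := NormedAlgebra.restrictScalars ℚ ℝ (A →L[ℝ] A)
  have he : ∀ (x : A) (t : ℝ), HasDerivAt (fun u : ℝ => NormedSpace.exp (u • D) x)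
      (D (NormedSpace.exp (t • D) x)) t := fun x t => by
    simpa using (hasDerivAt_exp_smul_const' D t).clm_apply (hasDerivAt_const t x)
  have hm : ∀ t : ℝ, HasDerivAt
      (fun u : ℝ => NormedSpace.exp (u • D) x * NormedSpace.exp (u • D) y)
      (D (NormedSpace.exp (t • D) x * NormedSpace.exp (t • D) y)) t := fun t => by
    rw [hD]
    have := ((mulCLM A).hasFDerivAt.comp_hasDerivAt t (he x t)).clm_apply (he y t)
    simpa using this
  have hn : ∀ t : ℝ, HasDerivAt (fun u : ℝ => NormedSpace.exp (u • (-D))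
      (NormedSpace.exp (u • D) x * NormedSpace.exp (u • D) y)) 0 t := fun t => by
    have := (hasDerivAt_exp_smul_const (-D) t).clm_apply (hm t)
    simpa using this
  have h := is_const_of_deriv_eq_zero (fun t => (hn t).differentiableAt) (fun t => (hn t).deriv) 1 0
  simp only [one_smul, zero_smul, NormedSpace.exp_zero, one_apply_eq_self] at h
  rw [← h, ← mul_apply_eq_comp, ← NormedSpace.exp_add_of_commute, add_neg_cancel,
    NormedSpace.exp_zero, one_apply_eq_self]
  exact (Commute.refl D).neg_right

theorem exists_autToEnd_eq_exp {D : A →L[ℝ] A} (hD : D ∈ derivations A) :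
    ∃ g : autGroup A, autToEnd g = NormedSpace.exp D := by
  have : CompleteSpace A := FiniteDimensional.complete ℝ A
  let := NormedAlgebra.restrictScalars ℚ ℝ (A →L[ℝ] A)
  refine ⟨⟨⟨NormedSpace.exp D, NormedSpace.exp (-D), ?_, ?_⟩, exp_apply_mul hD⟩, rfl⟩
  · rw [← NormedSpace.exp_add_of_commute (Commute.refl D).neg_right, add_neg_cancel,
      NormedSpace.exp_zero]
  · rw [← NormedSpace.exp_add_of_commute (Commute.refl D).neg_left, neg_add_cancel,
      NormedSpace.exp_zero]

theorem IsDivisionAlgebra.eq_zero_of_mul_self {B : Type*} [NonUnitalNonAssocRing B]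
    [IsDivisionAlgebra B] {x : B} (h : x * x = 0) : x = 0 := by
  by_contra hx
  exact hx ((IsDivisionAlgebra.mul_left_bijective x hx).injective
    (show x * x = x * 0 by rw [h, mul_zero]))

theorem isClosed_range_autToEnd [IsDivisionAlgebra A] :
    IsClosed (Set.range (autToEnd : autGroup A → A →L[ℝ] A)) := by
  rw [range_autToEnd, Set.ofPred_and]
  have hc : ∀ x : A, Continuous fun f : A →L[ℝ] A => f x := fun x => by fun_prop
  refine IsClosed.inter ?_ (isClosed_eq (hc 1) continuous_const)
  simp only [Set.ofPred_forall]
  refine isClosed_iInter fun x => isClosed_iInter fun y => isClosed_eq (hc _) ?_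
  exact ((mulCLM A).continuous.comp (hc x)).clm_apply (hc y)

-- Otherwise some normalized automorphisms `gₙ / ‖gₙ‖` with `‖gₙ‖ → ∞` converge to an `h` of norm
-- one. Multiplicativity is quadratic on one side and linear on the other, so a factor `‖gₙ‖⁻¹`
-- survives and the limit gives `h x * h x = 0`. Hence `h = 0`, a contradiction.
open Filter in
theorem isBounded_range_autToEnd [IsDivisionAlgebra A] :
    Bornology.IsBounded (Set.range (autToEnd : autGroup A → A →L[ℝ] A)) := by
  by_contra hb
  have hex : ∀ n : ℕ, ∃ g : autGroup A, (n : ℝ) < ‖autToEnd g‖ := by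
    intro n
    by_contra! hn
    exact hb (isBounded_iff_forall_norm_le.2 ⟨n, by rintro _ ⟨g, rfl⟩; exact hn g⟩)
  choose g hg using hex
  have hpos : ∀ n, 0 < ‖autToEnd (g n)‖ := fun n => (Nat.cast_nonneg n).trans_lt (hg n)
  have hs : ∀ n, ‖autToEnd (g n)‖⁻¹ • autToEnd (g n) ∈ Metric.sphere (0 : A →L[ℝ] A) 1 := fun n => by
    simp [norm_smul, (hpos n).ne']
  obtain ⟨h, hh, φ, hφ, hlim⟩ := (isCompact_sphere (0 : A →L[ℝ] A) 1).tendsto_subseq hs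
  have hinv : Tendsto (fun n => ‖autToEnd (g n)‖⁻¹) atTop (𝓝 0) :=
    tendsto_inv_atTop_zero.comp
      (tendsto_atTop_mono (fun n => (hg n).le) tendsto_natCast_atTop_atTop)
  have hzero : h = 0 := by
    ext x
    apply IsDivisionAlgebra.eq_zero_of_mul_self
    have hx : ∀ x, Tendsto (fun n => (‖autToEnd (g (φ n))‖⁻¹ • autToEnd (g (φ n))) x) atTop
        (𝓝 (h x)) := fun x =>
      ((ContinuousLinearMap.apply ℝ A x).continuous.tendsto h).comp hlim
    have h1 : Tendsto (fun n => (‖autToEnd (g (φ n))‖⁻¹ • autToEnd (g (φ n))) x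
        * (‖autToEnd (g (φ n))‖⁻¹ • autToEnd (g (φ n))) x) atTop (𝓝 (h x * h x)) :=
      ((mulCLM A).isBoundedBilinearMap.continuous.tendsto (h x, h x)).comp
        ((hx x).prodMk_nhds (hx x))
    have h2 := (hinv.comp hφ.tendsto_atTop).smul (hx (x * x))
    rw [zero_smul] at h2
    refine tendsto_nhds_unique h1 (h2.congr fun n => ?_)
    simp only [Function.comp_apply, smul_apply, autToEnd_apply_mul (g (φ n)),
      smul_mul_assoc, mul_smul_comm]
  rw [hzero] at hh
  simp at hh

instance [IsDivisionAlgebra A] : CompactSpace (autGroup A) := by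
  have : CompleteSpace A := FiniteDimensional.complete ℝ A
  refine ⟨isEmbedding_autToEnd.isCompact_iff.2 ?_⟩
  rw [Set.image_univ]
  exact Metric.isCompact_of_isClosed_isBounded isClosed_range_autToEnd isBounded_range_autToEnd

/-- A continuous injection of a compact space into a Hausdorff space is a closed embedding. -/
theorem isEmbedding_orbitMap [IsDivisionAlgebra A] (α : A) : IsEmbedding (orbitMap α) := by
  have : CompleteSpace A := FiniteDimensional.complete ℝ A
  refine (Continuous.isClosedEmbedding ?_
    (MulAction.injective_ofQuotientStabilizer (autGroup A) α)).isEmbedding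
  refine isQuotientMap_quotient_mk'.continuous_iff.2 ?_
  exact (ContinuousLinearMap.apply ℝ A α).continuous.comp isEmbedding_autToEnd.continuous

end Aut

/-! ### Inverse function theorem and linearization at the identity -/

/-- A smooth map with invertible derivative at a point restricts to a local diffeomorphism. -/
theorem ContDiff.exists_openPartialHomeomorph {X Y : Type*} [NormedAddCommGroup X]
    [NormedSpace ℝ X] [CompleteSpace X] [NormedAddCommGroup Y] [NormedSpace ℝ Y]
    {f : X → Y} (hf : ContDiff ℝ ∞ f) {a : X} {f' : X ≃L[ℝ] Y}
    (hf' : HasFDerivAt f (f' : X →L[ℝ] Y) a) :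
    ∃ e : OpenPartialHomeomorph X Y, a ∈ e.source ∧ (∀ x, e x = f x) ∧
      ContDiffOn ℝ ∞ e.symm e.target := by
  let e₀ := hf.contDiffAt.toOpenPartialHomeomorph f hf' (by simp)
  have he₀ : ∀ x, e₀ x = f x := fun _ => rfl
  -- Restricting to the open set where the derivative is invertible makes the inverse smooth on the
  -- whole target, not only at the image of `a`.
  let U : Set X := fderiv ℝ f ⁻¹' Set.range ContinuousLinearEquiv.toContinuousLinearMap
  have hU : IsOpen U := ContinuousLinearEquiv.isOpen.preimage (hf.continuous_fderiv (by simp))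
  refine ⟨e₀.restrOpen U hU, ⟨hf.contDiffAt.mem_toOpenPartialHomeomorph_source hf' (by simp),
    f', hf'.fderiv.symm⟩, he₀, fun y hy => ContDiffAt.contDiffWithinAt ?_⟩
  have hs := (e₀.restrOpen U hU).map_target hy
  obtain ⟨g', hg'⟩ := hs.2
  refine (e₀.restrOpen U hU).contDiffAt_symm (f₀' := g') hy ?_ hf.contDiffAt
  rw [hg']
  exact (hf.differentiable (by simp) _).hasFDerivAt

/-- If a space of endomorphisms contains no nonzero derivation of a bilinear map, then near the
identity its translate by the identity contains no other endomorphism preserving this map. -/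
theorem eventually_eq_zero_of_one_add_preserves {V X : Type*} [NormedAddCommGroup V]
    [NormedSpace ℝ V] [FiniteDimensional ℝ V] [NormedAddCommGroup X] [NormedSpace ℝ X]
    [FiniteDimensional ℝ X] (μ : V →L[ℝ] V →L[ℝ] V) (c : X →L[ℝ] (V →L[ℝ] V))
    (hc : ∀ w, (∀ x y, c w (μ x y) = μ (c w x) y + μ x (c w y)) → w = 0) :
    ∀ᶠ w in 𝓝 0, (∀ x y, (1 + c w) (μ x y) = μ ((1 + c w) x) ((1 + c w) y)) → w = 0 := by
  let β := Module.finBasis ℝ V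
  -- `F` is the failure of `1 + c w` to preserve `μ` on pairs of basis vectors. Its derivative `F'`
  -- at `0` is the failure of `c w` to satisfy the Leibniz rule, hence is injective by `hc`.
  let F : X → (Fin (Module.finrank ℝ V) × Fin (Module.finrank ℝ V) → V) := fun w p =>
    (1 + c w) (μ (β p.1) (β p.2)) - μ ((1 + c w) (β p.1)) ((1 + c w) (β p.2))
  let F' : X →L[ℝ] (Fin (Module.finrank ℝ V) × Fin (Module.finrank ℝ V) → V) :=
    ContinuousLinearMap.pi fun p =>
      (ContinuousLinearMap.apply ℝ V (μ (β p.1) (β p.2))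
        - (μ.flip (β p.2)) ∘L ContinuousLinearMap.apply ℝ V (β p.1)
        - (μ (β p.1)) ∘L ContinuousLinearMap.apply ℝ V (β p.2)) ∘L c
  have hF' : ∀ (w : X) (p), F' w p = c w (μ (β p.1) (β p.2))
      - μ (c w (β p.1)) (β p.2) - μ (β p.1) (c w (β p.2)) :=
    fun _ _ => rfl
  have hF : HasFDerivAt F F' 0 := by
    rw [hasFDerivAt_pi']
    intro p
    have h0 : HasFDerivAt (fun w : X => 1 + c w) c 0 := c.hasFDerivAt.const_add 1
    have h1 : ∀ x : V, HasFDerivAt (fun w : X => (1 + c w) x)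
        (ContinuousLinearMap.apply ℝ V x ∘L c) 0 := fun x =>
      (ContinuousLinearMap.apply ℝ V x).hasFDerivAt.comp (0 : X) h0
    have h2 := (h1 (μ (β p.1) (β p.2))).sub
      ((μ.hasFDerivAt.comp (0 : X) (h1 (β p.1))).clm_apply (h1 (β p.2)))
    refine h2.congr_fderiv ?_
    ext w
    simp [hF']
    abel
  have hinj : LinearMap.ker F'.toLinearMap = ⊥ := by
    rw [LinearMap.ker_eq_bot']
    intro w hw
    refine hc w ?_
    have key : (μ.toLinearMap₁₂).compr₂ (c w).toLinearMap
      = (μ.toLinearMap₁₂).comp (c w).toLinearMap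
        + (μ.toLinearMap₁₂).compl₂ (c w).toLinearMap := by
      refine β.ext fun i => β.ext fun j => ?_
      have := (hF' w (i, j)).symm.trans (congrFun hw (i, j))
      rw [sub_sub] at this
      exact sub_eq_zero.1 this
    intro x y
    exact congrArg (fun f => f x y) key
  -- An injective derivative in finite dimension is bounded below, so `F` has no zero near `0` other
  -- than `0`.
  obtain ⟨C, -, hC⟩ := LinearMap.exists_antilipschitzWith F'.toLinearMap hinj
  have hev := hF.eventually_ne (c := 0) ⟨C, hC⟩
  rw [eventually_nhdsWithin_iff] at hev
  filter_upwards [hev] with w hw hm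
  by_contra hne
  exact hw hne (funext fun p => sub_eq_zero.2 (hm _ _))

theorem hasFDerivAt_exp_comp {X 𝔸 : Type*} [NormedAddCommGroup X] [NormedSpace ℝ X]
    [NormedRing 𝔸] [NormedAlgebra ℝ 𝔸] [CompleteSpace 𝔸] (l : X →L[ℝ] 𝔸) :
    HasFDerivAt (fun x => NormedSpace.exp (l x)) l 0 := by
  have h : HasFDerivAt NormedSpace.exp (1 : 𝔸 →L[ℝ] 𝔸) (l 0) := by
    rw [map_zero]; exact hasFDerivAt_exp_zero
  exact h.comp (0 : X) l.hasFDerivAt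

theorem hasFDerivAt_exp_mul_exp_mul_one_add {X 𝔸 : Type*} [NormedAddCommGroup X]
    [NormedSpace ℝ X] [NormedRing 𝔸] [NormedAlgebra ℝ 𝔸] [CompleteSpace 𝔸]
    (l m n : X →L[ℝ] 𝔸) :
    HasFDerivAt (fun x => NormedSpace.exp (l x) * NormedSpace.exp (m x) * (1 + n x))
      (l + m + n) 0 := by
  refine (((hasFDerivAt_exp_comp l).mul' (hasFDerivAt_exp_comp m)).mul'
    (n.hasFDerivAt.const_add 1)).congr_fderiv ?_
  refine ContinuousLinearMap.ext fun p => ?_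
  simp
  abel

/-! ### Splitting the endomorphisms, and adapted parametrizations -/

section

variable {A : Type*} [NonAssocRingWithNorm A] [NormedSpace ℝ A]
  [IsScalarTower ℝ A A] [SMulCommClass ℝ A A] [FiniteDimensional ℝ A]

/-- The derivations annihilating `α`, with a complement in the space of all derivations, one of
the latter in the space of all endomorphisms, and one of the image of `α` under all derivations. -/
structure DerivationSplitting (α : A) where
  d : ℕ
  k : ℕ
  l : ℕ
  n : ℕ
  a : EuclideanSpace ℝ (Fin d) →L[ℝ] (A →L[ℝ] A)
  b : EuclideanSpace ℝ (Fin k) →L[ℝ] (A →L[ℝ] A)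
  c : EuclideanSpace ℝ (Fin l) →L[ℝ] (A →L[ℝ] A)
  v : EuclideanSpace ℝ (Fin n) →L[ℝ] A
  u : EuclideanSpace ℝ (Fin (d + k)) ≃L[ℝ] EuclideanSpace ℝ (Fin d) × EuclideanSpace ℝ (Fin k)
  groupEquiv : (EuclideanSpace ℝ (Fin (d + k)) × EuclideanSpace ℝ (Fin l)) ≃L[ℝ] (A →L[ℝ] A)
  orbitEquiv : (EuclideanSpace ℝ (Fin d) × EuclideanSpace ℝ (Fin n)) ≃L[ℝ] A
  a_mem : ∀ x, a x ∈ derivations A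
  b_mem : ∀ x, b x ∈ annihilatingDerivations α
  eq_zero_of_c_mem : ∀ w, c w ∈ derivations A → w = 0
  groupEquiv_apply : ∀ p, groupEquiv p = a (u p.1).1 + b (u p.1).2 + c p.2
  orbitEquiv_apply : ∀ p, orbitEquiv p = a p.1 α + v p.2

theorem nonempty_derivationSplitting (α : A) : Nonempty (DerivationSplitting α) := by
  obtain ⟨𝔪, hd, hs⟩ := IsModularLattice.exists_disjoint_and_sup_eq
    (inf_le_left : annihilatingDerivations α ≤ derivations A)
  obtain ⟨W, hW⟩ := Submodule.exists_isCompl (derivations A)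
  let a := 𝔪.subtypeL ∘L (toEuclidean (E := 𝔪)).symm.toContinuousLinearMap
  let b := (annihilatingDerivations α).subtypeL ∘L
    (toEuclidean (E := annihilatingDerivations α)).symm.toContinuousLinearMap
  let c := W.subtypeL ∘L (toEuclidean (E := W)).symm.toContinuousLinearMap
  have ha𝔪 : ∀ x, a x ∈ 𝔪 := fun x => ((toEuclidean (E := 𝔪)).symm x).2
  have ha : ∀ x, a x ∈ derivations A := fun x => hs ▸ Submodule.mem_sup_right (ha𝔪 x)
  have hb : ∀ x, b x ∈ annihilatingDerivations α := fun x =>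
    ((toEuclidean (E := annihilatingDerivations α)).symm x).2
  have ha0 : ∀ x, a x = 0 → x = 0 := fun x hx => by
    simpa [a] using hx
  have hb0 : ∀ x, b x = 0 → x = 0 := fun x hx => by
    simpa [b] using hx
  have hc : ∀ w, c w ∈ derivations A → w = 0 := fun w hw => by
    have : c w = 0 := Submodule.disjoint_def.1 hW.disjoint _ hw
      ((toEuclidean (E := W)).symm w).2
    simpa [c] using this
  let φ := (a.flip α)
  obtain ⟨N, hN⟩ := Submodule.exists_isCompl (LinearMap.range φ.toLinearMap)
  let v : EuclideanSpace ℝ (Fin (Module.finrank ℝ N)) →L[ℝ] A :=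
    N.subtypeL ∘L (toEuclidean (E := N)).symm.toContinuousLinearMap
  have hv : ∀ y, v y ∈ N := fun y => ((toEuclidean (E := N)).symm y).2
  have hv0 : ∀ y, v y = 0 → y = 0 := fun y hy => by
    simpa [v] using hy
  let u := ContinuousLinearEquiv.ofFinrankEq (𝕜 := ℝ)
    (E := EuclideanSpace ℝ (Fin (Module.finrank ℝ 𝔪 +
      Module.finrank ℝ (annihilatingDerivations α))))
    (F := EuclideanSpace ℝ (Fin (Module.finrank ℝ 𝔪)) ×
      EuclideanSpace ℝ (Fin (Module.finrank ℝ (annihilatingDerivations α)))) (by simp)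
  let t₁ : (EuclideanSpace ℝ (Fin (Module.finrank ℝ 𝔪 +
      Module.finrank ℝ (annihilatingDerivations α))) ×
      EuclideanSpace ℝ (Fin (Module.finrank ℝ W))) →ₗ[ℝ] (A →L[ℝ] A) :=
    LinearMap.coprod ((a.coprod b).toLinearMap ∘ₗ u.toLinearMap) c.toLinearMap
  have ht₁ : ∀ p, t₁ p = a (u p.1).1 + b (u p.1).2 + c p.2 := fun p => rfl
  let t₂ : (EuclideanSpace ℝ (Fin (Module.finrank ℝ 𝔪)) ×
      EuclideanSpace ℝ (Fin (Module.finrank ℝ N))) →ₗ[ℝ] A :=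
    LinearMap.coprod φ.toLinearMap v.toLinearMap
  have ht₂ : ∀ p, t₂ p = a p.1 α + v p.2 := fun p => rfl
  -- A derivation in `𝔪` killing `α` lies in both complementary summands; so evaluation at `α`
  -- embeds `𝔪` into `A`.
  have hker : ∀ x, a x α = 0 → x = 0 := fun x hx =>
    ha0 x (Submodule.disjoint_def.1 hd _ ⟨ha x, hx⟩ (ha𝔪 x))
  have h₁ : Function.Bijective t₁ := by
    constructor
    · rw [injective_iff_map_eq_zero]
      rintro ⟨e, w⟩ h
      rw [ht₁] at h
      have hw : w = 0 := by
        refine hc w ?_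
        rw [← neg_eq_of_add_eq_zero_right h]
        exact neg_mem (add_mem (ha _) (hb _).1)
      rw [hw, map_zero, add_zero] at h
      have hx : a (u e).1 = 0 := by
        refine Submodule.disjoint_def.1 hd _ ?_ (ha𝔪 _)
        rw [← neg_eq_of_add_eq_zero_left h]
        exact neg_mem (hb _)
      rw [hx, zero_add] at h
      have hu : u e = 0 := Prod.ext (ha0 _ hx) (hb0 _ h)
      exact Prod.ext (by simpa using hu) hw
    · intro f
      obtain ⟨D, hD, w, hw, rfl⟩ := Submodule.mem_sup.1
        (hW.sup_eq_top ▸ Submodule.mem_top : f ∈ derivations A ⊔ W)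
      rw [← hs] at hD
      obtain ⟨z, hz, x, hx, rfl⟩ := Submodule.mem_sup.1 hD
      refine ⟨(u.symm (toEuclidean (⟨x, hx⟩ : 𝔪),
        toEuclidean (⟨z, hz⟩ : annihilatingDerivations α)), toEuclidean (⟨w, hw⟩ : W)), ?_⟩
      rw [ht₁]
      simp [a, b, c, add_comm z x]
  have h₂ : Function.Bijective t₂ := by
    constructor
    · rw [injective_iff_map_eq_zero]
      rintro ⟨x, n⟩ h
      rw [ht₂] at h
      have hn : v n = 0 := by
        refine Submodule.disjoint_def.1 hN.disjoint _ ?_ (hv n)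
        rw [← neg_eq_of_add_eq_zero_right h]
        exact neg_mem ⟨x, rfl⟩
      rw [hn, add_zero] at h
      exact Prod.ext (hker _ h) (hv0 _ hn)
    · intro f
      obtain ⟨_, ⟨x, rfl⟩, n, hn, rfl⟩ := Submodule.mem_sup.1
        (hN.sup_eq_top ▸ Submodule.mem_top : f ∈ LinearMap.range φ.toLinearMap ⊔ N)
      refine ⟨(x, toEuclidean (⟨n, hn⟩ : N)), ?_⟩
      rw [ht₂]
      simp [v, φ]
  exact ⟨{
    d := _, k := _, l := _, n := _, a := a, b := b, c := c, v := v, u := u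
    groupEquiv := (LinearEquiv.ofBijective t₁ h₁).toContinuousLinearEquiv
    orbitEquiv := (LinearEquiv.ofBijective t₂ h₂).toContinuousLinearEquiv
    a_mem := ha
    b_mem := hb
    eq_zero_of_c_mem := hc
    groupEquiv_apply := ht₁
    orbitEquiv_apply := ht₂ }⟩

namespace DerivationSplitting

variable {α : A} (S : DerivationSplitting α)

/-- Coordinates on the endomorphisms near the identity adapted to the automorphism group. -/
noncomputable def groupParam (p : EuclideanSpace ℝ (Fin (S.d + S.k)) × EuclideanSpace ℝ (Fin S.l)) : A →L[ℝ] A :=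
  NormedSpace.exp (S.a (S.u p.1).1) * NormedSpace.exp (S.b (S.u p.1).2) * (1 + S.c p.2)

/-- Coordinates on the algebra near `α` adapted to the orbit of `α`. -/
noncomputable def orbitParam (p : EuclideanSpace ℝ (Fin S.d) × EuclideanSpace ℝ (Fin S.n)) : A :=
  NormedSpace.exp (S.a p.1) α + S.v p.2

theorem groupParam_zero : S.groupParam 0 = 1 := by simp [groupParam]

theorem contDiff_groupParam : ContDiff ℝ ∞ S.groupParam := by
  have h1 : ContDiff ℝ ∞ fun p : EuclideanSpace ℝ (Fin (S.d + S.k)) × EuclideanSpace ℝ (Fin S.l) =>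
      S.a (S.u p.1).1 := by fun_prop
  have h2 : ContDiff ℝ ∞ fun p : EuclideanSpace ℝ (Fin (S.d + S.k)) × EuclideanSpace ℝ (Fin S.l) =>
      S.b (S.u p.1).2 := by fun_prop
  have h3 : ContDiff ℝ ∞ fun p : EuclideanSpace ℝ (Fin (S.d + S.k)) × EuclideanSpace ℝ (Fin S.l) =>
      S.c p.2 := S.c.contDiff.comp contDiff_snd
  exact ((contDiff_exp_end.comp h1).mul (contDiff_exp_end.comp h2)).mul (contDiff_const.add h3)

theorem contDiff_orbitParam : ContDiff ℝ ∞ S.orbitParam := by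
  have h1 : ContDiff ℝ ∞ fun p : EuclideanSpace ℝ (Fin S.d) × EuclideanSpace ℝ (Fin S.n) => S.a p.1 := by fun_prop
  have h3 : ContDiff ℝ ∞ fun p : EuclideanSpace ℝ (Fin S.d) × EuclideanSpace ℝ (Fin S.n) =>
      S.v p.2 :=
    S.v.contDiff.comp contDiff_snd
  exact ((contDiff_exp_end.comp h1).clm_apply contDiff_const).add h3

theorem hasFDerivAt_groupParam :
    HasFDerivAt S.groupParam (S.groupEquiv : _ →L[ℝ] (A →L[ℝ] A)) 0 := by
  have : CompleteSpace A := FiniteDimensional.complete ℝ A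
  let v := S.u.toContinuousLinearMap ∘L ContinuousLinearMap.fst ℝ
    (EuclideanSpace ℝ (Fin (S.d + S.k))) (EuclideanSpace ℝ (Fin S.l))
  refine (hasFDerivAt_exp_mul_exp_mul_one_add
    (S.a ∘L ContinuousLinearMap.fst ℝ _ _ ∘L v) (S.b ∘L ContinuousLinearMap.snd ℝ _ _ ∘L v)
    (S.c ∘L ContinuousLinearMap.snd ℝ _ _)).congr_fderiv ?_
  exact ContinuousLinearMap.ext fun p => (S.groupEquiv_apply p).symm

theorem hasFDerivAt_orbitParam :
    HasFDerivAt S.orbitParam (S.orbitEquiv : _ →L[ℝ] A) 0 := by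
  have h1 := hasFDerivAt_exp_comp (S.a ∘L ContinuousLinearMap.fst ℝ (EuclideanSpace ℝ (Fin S.d)) (EuclideanSpace ℝ (Fin S.n)))
  have h3 : HasFDerivAt (fun p : EuclideanSpace ℝ (Fin S.d) × EuclideanSpace ℝ (Fin S.n) => S.v p.2)
      (S.v ∘L ContinuousLinearMap.snd ℝ _ _) 0 :=
    S.v.hasFDerivAt.comp _ hasFDerivAt_snd
  refine ((h1.clm_apply (hasFDerivAt_const α _)).add h3).congr_fderiv ?_
  refine ContinuousLinearMap.ext fun p => ?_
  simp [S.orbitEquiv_apply]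

end DerivationSplitting

end

/-! ### Slice charts at the identity and at `α` -/

section

variable {A : Type*} [NonAssocRingWithNorm A] [NormedSpace ℝ A]

theorem autToEnd_mul_mem_range_iff (g : autGroup A) (f : A →L[ℝ] A) :
    autToEnd g * f ∈ Set.range (autToEnd (A := A)) ↔ f ∈ Set.range (autToEnd (A := A)) := by
  constructor
  · rintro ⟨h, hh⟩
    refine ⟨g⁻¹ * h, ?_⟩
    rw [autToEnd_mul, hh, ← mul_assoc, autToEnd_inv_mul, one_mul]
  · rintro ⟨h, rfl⟩
    exact ⟨g * h, rfl⟩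

/-- Left multiplication by an automorphism on the space of endomorphisms. -/
noncomputable def autMulLeft (g : autGroup A) : (A →L[ℝ] A) ≃L[ℝ] (A →L[ℝ] A) :=
  ContinuousLinearEquiv.equivOfInverse (ContinuousLinearMap.mul ℝ (A →L[ℝ] A) (autToEnd g))
    (ContinuousLinearMap.mul ℝ (A →L[ℝ] A) (autToEnd g⁻¹))
    (fun f => by
      change autToEnd g⁻¹ * (autToEnd g * f) = f
      rw [← mul_assoc, autToEnd_inv_mul, one_mul])
    (fun f => by
      change autToEnd g * (autToEnd g⁻¹ * f) = f
      rw [← mul_assoc, autToEnd_mul_inv, one_mul])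

/-- An automorphism as a continuous linear equivalence. -/
noncomputable def autEquiv (g : autGroup A) : A ≃L[ℝ] A :=
  ContinuousLinearEquiv.unitsEquiv ℝ A (g : (A →L[ℝ] A)ˣ)

theorem autEquiv_mem_orbit_iff (g : autGroup A) (α x : A) :
    autEquiv g x ∈ MulAction.orbit (autGroup A) α ↔ x ∈ MulAction.orbit (autGroup A) α :=
  ⟨fun h => by simpa using MulAction.mem_orbit_of_mem_orbit g⁻¹ (show g • x ∈ _ from h),
    fun h => MulAction.mem_orbit_of_mem_orbit g h⟩

variable [IsScalarTower ℝ A A] [SMulCommClass ℝ A A] [FiniteDimensional ℝ A]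

namespace DerivationSplitting

variable {α : A} (S : DerivationSplitting α)

/-- Both exponential factors are automorphisms and can be cancelled on the left. -/
theorem groupParam_mem_range_iff (p : EuclideanSpace ℝ (Fin (S.d + S.k)) ×
    EuclideanSpace ℝ (Fin S.l)) : S.groupParam p ∈ Set.range (autToEnd (A := A))
      ↔ 1 + S.c p.2 ∈ Set.range (autToEnd (A := A)) := by
  obtain ⟨g, hg⟩ := exists_autToEnd_eq_exp (S.a_mem (S.u p.1).1)
  obtain ⟨h, hh⟩ := exists_autToEnd_eq_exp (S.b_mem (S.u p.1).2).1
  rw [groupParam, ← hg, ← hh, ← autToEnd_mul, autToEnd_mul_mem_range_iff]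

theorem groupParam_apply (e : EuclideanSpace ℝ (Fin (S.d + S.k))) :
    S.groupParam (e, 0) α = S.orbitParam ((S.u e).1, 0) := by
  have h : NormedSpace.exp (S.b (S.u e).2) α = α :=
    NormedSpace.exp_apply_eq_of_apply_eq_zero (S.b_mem (S.u e).2).2
  simp [groupParam, orbitParam, h]

theorem orbitParam_mem_orbit (x : EuclideanSpace ℝ (Fin S.d)) :
    S.orbitParam (x, 0) ∈ MulAction.orbit (autGroup A) α := by
  obtain ⟨g, hg⟩ := exists_autToEnd_eq_exp (S.a_mem x)
  refine ⟨g, ?_⟩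
  change autToEnd g α = _
  simp [orbitParam, hg]

/-- Slice charts of the automorphism group and of an orbit in which the orbit map is a linear
projection. -/
theorem exists_isSliceChart [IsDivisionAlgebra A] :
    ∃ (ψ : OpenPartialHomeomorph (A →L[ℝ] A)
        (EuclideanSpace ℝ (Fin (S.d + S.k)) × EuclideanSpace ℝ (Fin S.l)))
      (χ : OpenPartialHomeomorph A (EuclideanSpace ℝ (Fin S.d) × EuclideanSpace ℝ (Fin S.n))),
      IsSliceChart (Set.range autToEnd) ψ ∧ 1 ∈ ψ.source ∧
      IsSliceChart (MulAction.orbit (autGroup A) α) χ ∧ α ∈ χ.source ∧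
      ∀ g : autGroup A, autToEnd g ∈ ψ.source → autToEnd g α ∈ χ.source ∧
        (χ (autToEnd g α)).1 = (S.u (ψ (autToEnd g)).1).1 := by
  have : CompleteSpace A := FiniteDimensional.complete ℝ A
  obtain ⟨e₁, h0₁, he₁, hs₁⟩ :=
    S.contDiff_groupParam.exists_openPartialHomeomorph S.hasFDerivAt_groupParam
  obtain ⟨e₂, h0₂, he₂, hs₂⟩ :=
    S.contDiff_orbitParam.exists_openPartialHomeomorph S.hasFDerivAt_orbitParam
  have hev := eventually_eq_zero_of_one_add_preserves (mulCLM A) S.c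
    fun w h => S.eq_zero_of_c_mem w h
  obtain ⟨O, hO, hOo, hO0⟩ := eventually_nhds_iff.1 hev
  have hO' : ∀ w ∈ O, 1 + S.c w ∈ Set.range (autToEnd (A := A)) → w = 0 := by
    rintro w hw ⟨g, hg⟩
    refine hO w hw fun x y => ?_
    rw [← hg]
    exact autToEnd_apply_mul g x y
  -- The first condition forces the transverse coordinate of an automorphism to vanish; the second
  -- keeps its image of `α` within reach of the orbit coordinates.
  let U : Set (EuclideanSpace ℝ (Fin (S.d + S.k)) × EuclideanSpace ℝ (Fin S.l)) :=
    {p | p.2 ∈ O ∧ ((S.u p.1).1, 0) ∈ e₂.source}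
  have hU : IsOpen U := (hOo.preimage continuous_snd).inter
    (e₂.open_source.preimage (f := fun p : EuclideanSpace ℝ (Fin (S.d + S.k)) ×
      EuclideanSpace ℝ (Fin S.l) => ((S.u p.1).1, (0 : EuclideanSpace ℝ (Fin S.n))))
      (by fun_prop))
  let e₁' := e₁.restrOpen U hU
  have he₁' : ∀ p, e₁' p = S.groupParam p := he₁
  have h0₁' : 0 ∈ e₁'.source := ⟨h0₁, hO0, by
    rw [Prod.fst_zero, map_zero, Prod.fst_zero]; exact h0₂⟩
  have h1 : 1 ∈ e₁'.target := by
    have := e₁'.map_source h0₁'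
    rwa [he₁', S.groupParam_zero] at this
  have hsnd : ∀ p ∈ e₁'.source, S.groupParam p ∈ Set.range (autToEnd (A := A)) ↔ p.2 = 0 := by
    intro p hp
    rw [S.groupParam_mem_range_iff]
    refine ⟨hO' _ hp.2.1, fun h => ⟨1, ?_⟩⟩
    rw [h, map_zero, add_zero, autToEnd_one]
  have hloc : ∀ g : autGroup A, autToEnd g ∈ e₁'.target →
      ((S.u (e₁'.symm (autToEnd g)).1).1, 0) ∈ e₂.source ∧
      S.orbitParam ((S.u (e₁'.symm (autToEnd g)).1).1, 0) = autToEnd g α := by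
    intro g hg
    have hp := e₁'.map_target hg
    have hgp : S.groupParam (e₁'.symm (autToEnd g)) = autToEnd g := by
      rw [← he₁', e₁'.right_inv hg]
    have h2 := (hsnd _ hp).1 ⟨g, hgp.symm⟩
    refine ⟨hp.2.2, ?_⟩
    rw [← S.groupParam_apply, ← h2, hgp]
  -- The image in `G/H` of the chart neighbourhood of `1` is open, so it is cut out by an open `T ⊆
  -- A`. Every orbit point in `T` is then `g α` with `g` in that neighbourhood, which excludes other
  -- sheets of the orbit.
  obtain ⟨T, hTo, hT⟩ := (isEmbedding_orbitMap α).isOpen_iff.1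
    (QuotientGroup.isOpenMap_coe (N := MulAction.stabilizer (autGroup A) α) _
      (e₁'.open_target.preimage isEmbedding_autToEnd.continuous))
  have hT' : ∀ g : autGroup A, autToEnd g ∈ e₁'.target → autToEnd g α ∈ T := by
    intro g hg
    change (g : autGroup A ⧸ MulAction.stabilizer (autGroup A) α) ∈ orbitMap α ⁻¹' T
    rw [hT]
    exact ⟨g, hg, rfl⟩
  let e₂' := e₂.restrOpen (S.orbitParam ⁻¹' T) (hTo.preimage S.contDiff_orbitParam.continuous)
  have he₂' : ∀ p, e₂' p = S.orbitParam p := he₂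
  have hfin : ∀ g : autGroup A, autToEnd g ∈ e₁'.target → autToEnd g α ∈ e₂'.target ∧
      e₂'.symm (autToEnd g α) = ((S.u (e₁'.symm (autToEnd g)).1).1, 0) := by
    intro g hg
    obtain ⟨hx, hxe⟩ := hloc g hg
    have hx' : ((S.u (e₁'.symm (autToEnd g)).1).1, 0) ∈ e₂'.source :=
      ⟨hx, by rw [Set.mem_preimage, hxe]; exact hT' g hg⟩
    rw [← hxe, ← he₂']
    exact ⟨e₂'.map_source hx', e₂'.left_inv hx'⟩
  refine ⟨e₁'.symm, e₂'.symm, ⟨hs₁.mono fun _ h => h.1, ?_, ?_⟩, h1,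
    ⟨hs₂.mono fun _ h => h.1, ?_, ?_⟩, ?_, fun g hg => ⟨(hfin g hg).1, ?_⟩⟩
  · exact S.contDiff_groupParam.contDiffOn.congr fun p _ => he₁' p
  · intro v hv
    rw [← hsnd _ (e₁'.map_target hv), ← he₁', e₁'.right_inv hv]
  · exact S.contDiff_orbitParam.contDiffOn.congr fun p _ => he₂' p
  · intro x hx
    have hxp : S.orbitParam (e₂'.symm x) = x := by rw [← he₂', e₂'.right_inv hx]
    constructor
    · intro hxo
      rw [← range_orbitMap] at hxo
      obtain ⟨q, rfl⟩ := hxo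
      have hq : q ∈ orbitMap α ⁻¹' T := by
        have := (e₂'.map_target hx).2
        rwa [Set.mem_preimage, hxp] at this
      rw [hT] at hq
      obtain ⟨g, hg, rfl⟩ := hq
      exact congrArg Prod.snd (hfin g hg).2
    · intro h
      rw [← hxp, show e₂'.symm x = ((e₂'.symm x).1, 0) from Prod.ext rfl h]
      exact S.orbitParam_mem_orbit _
  · exact (hfin 1 h1).1
  · exact congrArg Prod.fst (hfin g hg).2

end DerivationSplitting

end

/-! ### Lie group structure and the homogeneous space -/

/-- A group embedded into the units of a Banach algebra as a smooth submanifold is a Lie group. -/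
theorem lieGroup_of_isSmoothEmbedding {E 𝔸 G : Type*} [NormedAddCommGroup E]
    [NormedSpace ℝ E] [NormedRing 𝔸] [NormedAlgebra ℝ 𝔸]
    [CompleteSpace 𝔸] [TopologicalSpace G] [Group G] [IsTopologicalGroup G] [ChartedSpace E G]
    [IsManifold 𝓘(ℝ, E) ∞ G] (ρ : G →* 𝔸ˣ)
    (hρ : Manifold.IsSmoothEmbedding 𝓘(ℝ, E) 𝓘(ℝ, 𝔸) ∞ fun g => (ρ g : 𝔸)) :
    LieGroup 𝓘(ℝ, E) ∞ G where
  contMDiff_mul := by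
    -- A continuous map into `G` is smooth once its composite with the immersion into `𝔸` is; there
    -- the product is smooth, and inversion becomes `Ring.inverse`, smooth at units.
    rw [ContMDiff.iff_comp_isImmersion hρ.isImmersion]
    refine ⟨continuous_mul, ?_⟩
    have h : ContMDiff (𝓘(ℝ, E).prod 𝓘(ℝ, E)) 𝓘(ℝ, 𝔸) ∞
        fun p : G × G => (ρ p.1 : 𝔸) * (ρ p.2 : 𝔸) :=
      (contDiff_mul (𝕜 := ℝ) (𝔸 := 𝔸)).comp_contMDiff
        ((hρ.contMDiff.comp contMDiff_fst).prodMk_space (hρ.contMDiff.comp contMDiff_snd))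
    refine h.congr fun p => ?_
    simp
  contMDiff_inv := by
    rw [ContMDiff.iff_comp_isImmersion hρ.isImmersion]
    refine ⟨continuous_inv, fun g => ?_⟩
    have h : ContMDiffAt 𝓘(ℝ, E) 𝓘(ℝ, 𝔸) ∞ (fun g => Ring.inverse (ρ g : 𝔸)) g :=
      ContDiffAt.comp_contMDiffAt (f := fun g => (ρ g : 𝔸)) (x := g)
        (contDiffAt_ringInverse ℝ (ρ g)) hρ.contMDiff.contMDiffAt
    refine h.congr_of_eventuallyEq (Filter.Eventually.of_forall fun x => ?_)
    simp

theorem mainTheorem2 {A : Type*} [NonAssocRingWithNorm A] [NormedSpace ℝ A]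
    [IsScalarTower ℝ A A] [SMulCommClass ℝ A A] [FiniteDimensional ℝ A] [IsDivisionAlgebra A]
    (P : ℝ[X]) (α : A) (hroot : α ∈ zeroSet P) (hα : α ∉ Set.center A) :
    MulAction.orbit (autGroup A) α ⊆ zeroSet P ∧
    ∃ (m : ℕ) (_ : ChartedSpace (EuclideanSpace ℝ (Fin m)) (autGroup A))
      (_ : LieGroup 𝓘(ℝ, EuclideanSpace ℝ (Fin m)) ∞ (autGroup A)),
      Manifold.IsSmoothEmbedding 𝓘(ℝ, EuclideanSpace ℝ (Fin m)) 𝓘(ℝ, A →L[ℝ] A) ∞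
        (fun g : autGroup A => ((g : (A →L[ℝ] A)ˣ) : A →L[ℝ] A)) ∧
    ∃ (d : ℕ)
      (_ : ChartedSpace (EuclideanSpace ℝ (Fin d))
        (autGroup A ⧸ MulAction.stabilizer (autGroup A) α))
      (_ : IsManifold 𝓘(ℝ, EuclideanSpace ℝ (Fin d)) ∞
        (autGroup A ⧸ MulAction.stabilizer (autGroup A) α)),
      Manifold.IsSubmersion 𝓘(ℝ, EuclideanSpace ℝ (Fin m)) 𝓘(ℝ, EuclideanSpace ℝ (Fin d)) ∞
        (fun g : autGroup A => (g : autGroup A ⧸ MulAction.stabilizer (autGroup A) α)) ∧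
    ∃ (_ : ChartedSpace (EuclideanSpace ℝ (Fin d)) (MulAction.orbit (autGroup A) α))
      (_ : IsManifold 𝓘(ℝ, EuclideanSpace ℝ (Fin d)) ∞ (MulAction.orbit (autGroup A) α)),
      Manifold.IsSmoothEmbedding 𝓘(ℝ, EuclideanSpace ℝ (Fin d)) 𝓘(ℝ, A) ∞
        (Subtype.val : MulAction.orbit (autGroup A) α → A) ∧
    ∃ Φ : Diffeomorph 𝓘(ℝ, EuclideanSpace ℝ (Fin d)) 𝓘(ℝ, EuclideanSpace ℝ (Fin d))
        (autGroup A ⧸ MulAction.stabilizer (autGroup A) α) (MulAction.orbit (autGroup A) α) ∞,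
      ∀ g : autGroup A, (Φ (g : autGroup A ⧸ MulAction.stabilizer (autGroup A) α) : A)
        = g • α := by
  have : CompleteSpace A := FiniteDimensional.complete ℝ A
  refine ⟨orbit_subset_zeroSet hroot, ?_⟩
  obtain ⟨S⟩ := nonempty_derivationSplitting α
  obtain ⟨ψ, χ, hψ, h1, hχ, hα', hproj⟩ := S.exists_isSliceChart
  have hQ : IsEmbedding (orbitMap α) := isEmbedding_orbitMap α
  have hχQ : IsSliceChart (Set.range (orbitMap α)) χ := (range_orbitMap α).symm ▸ hχ
  have hχO : IsSliceChart
      (Set.range (Subtype.val : MulAction.orbit (autGroup A) α → A)) χ := by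
    rwa [Subtype.range_val]
  have hψg : ∀ g : autGroup A, IsSliceChart (Set.range autToEnd)
      ((autMulLeft g⁻¹).toHomeomorph.transOpenPartialHomeomorph ψ) := fun g =>
    hψ.transport (autMulLeft g⁻¹) (autToEnd_mul_mem_range_iff g⁻¹)
  have hQg : ∀ g : autGroup A, IsSliceChart (Set.range (orbitMap α))
      ((autEquiv g⁻¹).toHomeomorph.transOpenPartialHomeomorph χ) := fun g =>
    hχQ.transport (autEquiv g⁻¹) fun x => by
      rw [range_orbitMap]
      exact autEquiv_mem_orbit_iff g⁻¹ α x
  have hOg : ∀ g : autGroup A,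
      IsSliceChart (Set.range (Subtype.val : MulAction.orbit (autGroup A) α → A))
      ((autEquiv g⁻¹).toHomeomorph.transOpenPartialHomeomorph χ) := fun g =>
    hχO.transport (autEquiv g⁻¹) fun x => by
      rw [Subtype.range_val]
      exact autEquiv_mem_orbit_iff g⁻¹ α x
  have hψs : ∀ g : autGroup A,
      autToEnd g ∈ ((autMulLeft g⁻¹).toHomeomorph.transOpenPartialHomeomorph ψ).source :=
    fun g => by
      change autToEnd g⁻¹ * autToEnd g ∈ ψ.source
      rwa [autToEnd_inv_mul]
  have hχs : ∀ g : autGroup A,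
      autToEnd g α ∈ ((autEquiv g⁻¹).toHomeomorph.transOpenPartialHomeomorph χ).source :=
    fun g => by
      change autToEnd g⁻¹ (autToEnd g α) ∈ χ.source
      rwa [autToEnd_inv_apply]
  have : Nonempty (MulAction.orbit (autGroup A) α) := (MulAction.nonempty_orbit α).to_subtype
  have cG : ∀ g : autGroup A, ∃ ψ' : OpenPartialHomeomorph (A →L[ℝ] A)
        (EuclideanSpace ℝ (Fin (S.d + S.k)) × EuclideanSpace ℝ (Fin S.l)),
      IsSliceChart (Set.range autToEnd) ψ' ∧ autToEnd g ∈ ψ'.source :=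
    fun g => ⟨_, hψg g, hψs g⟩
  have cQ : ∀ q : autGroup A ⧸ MulAction.stabilizer (autGroup A) α,
      ∃ χ' : OpenPartialHomeomorph A
        (EuclideanSpace ℝ (Fin S.d) × EuclideanSpace ℝ (Fin S.n)),
      IsSliceChart (Set.range (orbitMap α)) χ' ∧ orbitMap α q ∈ χ'.source := fun q => by
    induction q using QuotientGroup.induction_on with
    | H g => exact ⟨_, hQg g, hχs g⟩
  have cO : ∀ x : MulAction.orbit (autGroup A) α, ∃ χ' : OpenPartialHomeomorph A
        (EuclideanSpace ℝ (Fin S.d) × EuclideanSpace ℝ (Fin S.n)),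
      IsSliceChart (Set.range (Subtype.val : MulAction.orbit (autGroup A) α → A)) χ' ∧
        (x : A) ∈ χ'.source := by
    rintro ⟨_, g, rfl⟩
    exact ⟨_, hOg g, hχs g⟩
  let := sliceChartedSpace isEmbedding_autToEnd cG
  -- `G/H` gets its charts from its embedding into `A` as the orbit.
  let := sliceChartedSpace hQ cQ
  let := sliceChartedSpace IsEmbedding.subtypeVal cO
  have := isManifold_slice isEmbedding_autToEnd cG
  have := isManifold_slice hQ cQ
  have := isManifold_slice IsEmbedding.subtypeVal cO
  have eG := isSmoothEmbedding_slice isEmbedding_autToEnd cG S.groupEquiv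
  have eQ := isSmoothEmbedding_slice hQ cQ S.orbitEquiv
  have eO := isSmoothEmbedding_slice IsEmbedding.subtypeVal cO S.orbitEquiv
  refine ⟨S.d + S.k, inferInstance,
    lieGroup_of_isSmoothEmbedding (autGroup A).subtype eG, eG,
    S.d, inferInstance, inferInstance, ?_, inferInstance, inferInstance, eO, ?_⟩
  · refine ⟨EuclideanSpace ℝ (Fin S.k), inferInstance, inferInstance, fun g => ?_⟩
    -- Equivariance reduces charts at `g` to charts at `1`: apply the local statement to `g⁻¹ * h`.
    have hp : ∀ h : autGroup A,
        autToEnd h ∈ ((autMulLeft g⁻¹).toHomeomorph.transOpenPartialHomeomorph ψ).source →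
        autToEnd h α ∈ ((autEquiv g⁻¹).toHomeomorph.transOpenPartialHomeomorph χ).source ∧
        (((autEquiv g⁻¹).toHomeomorph.transOpenPartialHomeomorph χ) (autToEnd h α)).1
          = (S.u (((autMulLeft g⁻¹).toHomeomorph.transOpenPartialHomeomorph ψ)
            (autToEnd h)).1).1 := fun h hh => hproj (g⁻¹ * h) hh
    refine Manifold.IsSubmersionAtOfComplement.mk_of_charts S.u
      ((hψg g).toChart isEmbedding_autToEnd) ((hQg g).toChart hQ) (hψs g) (hχs g)
      ((hψg g).toChart_mem_maximalAtlas isEmbedding_autToEnd cG)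
      ((hQg g).toChart_mem_maximalAtlas hQ cQ) (fun h hh => (hp h hh).1) ?_
    intro e he
    have he' : e ∈ ((hψg g).toChart isEmbedding_autToEnd).target := by simpa using he
    refine (hp _ (((hψg g).toChart isEmbedding_autToEnd).map_target he')).2.trans ?_
    exact congrArg (fun e => (S.u e).1)
      (((hψg g).toChart isEmbedding_autToEnd).right_inv he')
  -- `G/H` and the orbit are both smoothly embedded in `A` and `Φ` commutes with the embeddings, so
  -- smoothness both ways follows by composing into `A`.
  · let Φ := (MulAction.orbitEquivQuotientStabilizer (autGroup A) α).symm
    have hΦ : Subtype.val ∘ Φ = orbitMap α := by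
      funext q
      induction q using QuotientGroup.induction_on with
      | H g => rfl
    have hΦ' : orbitMap α ∘ Φ.symm = Subtype.val := by
      funext x
      rw [← hΦ]
      simp
    refine ⟨⟨Φ, ?_, ?_⟩, fun g => rfl⟩
    · rw [ContMDiff.iff_comp_isImmersion eO.isImmersion, hΦ]
      refine ⟨?_, eQ.contMDiff⟩
      rw [IsEmbedding.subtypeVal.continuous_iff, hΦ]
      exact hQ.continuous
    · rw [ContMDiff.iff_comp_isImmersion eQ.isImmersion]
      refine ⟨?_, ?_⟩
      · rw [hQ.continuous_iff]
        exact hΦ' ▸ continuous_subtype_val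
      · change ContMDiff _ _ _ (orbitMap α ∘ Φ.symm)
        rw [hΦ']
        exact eO.contMDiff
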